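/- All multifunctions are defined on $[0,1]$ with Lebesgue measure $\lambda$. For a real Banach space $X$ let $cb(X)$ (resp. $cwk(X)$) be the family of nonempty closed convex bounded (resp. weakly compact) subsets of $X$, let $s(x^*,C)=\sup_{x\in C}\langle x^*,x\rangle$, and let $d_H$ be the Hausdorff distance. A multifunction $\Gamma:[0,1]\to cb(X)$ is *McShane* (resp. *Henstock*) integrable with integral $\Phi\in cb(X)$ if for every $\varepsilon>0$ there is a gauge $\delta:[0,1]\to(0,\infty)$ with $d_H\big(\Phi,\sum_i\Gamma(t_i)\lambda(I_i)\big)<\varepsilon$ for every finite partition $\{(I_i,t_i)\}$ of $[0,1]$ into non-overlapping closed intervals $I_i$ with tags $t_i\in[0,1]$ (resp. $t_i\in I_i$) satisfying $I_i\subset[t_i-\delta(t_i),t_i+\delta(t_i)]$. If the gauges can be taken Lebesgue measurable, $\Gamma$ is called *Birkhoff* (resp. *$\mathcal H$*-) integrable. $\Gamma$ is *variationally McShane* (resp. *variationally Henstock*) integrable if for every closed interval $I\subset[0,1]$ the multifunction equal to $\Gamma$ on $I$ and to $\{0\}$ off $I$ has a McShane (resp. Henstock) integral $\Phi_\Gamma(I)\in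 cb(X)$, and for every $\varepsilon>0$ there is a gauge $\delta$ such that $\sum_i d_H\big(\Phi_\Gamma(I_i),\Gamma(t_i)\lambda(I_i)\big)<\varepsilon$ for all partitions of the corresponding type as above. $\Gamma$ is *Pettis* integrable (in $cwk(X)$) if $s(x^*,\Gamma)$ is Lebesgue integrable for every $x^*\in X^*$ and for every Lebesgue measurable $A\subset[0,1]$ there is $M_A\in cwk(X)$ with $s(x^*,M_A)=\int_A s(x^*,\Gamma)\,d\lambda$ for all $x^*\in X^*$. A function $g:[0,1]\to X$ is integrable in one of these senses if $t\mapsto\{g(t)\}$ is. **Proposition.** There exist a Banach space $X$ and a function $f:[0,1]\to X$ that is variationally Henstock integrable and Pettis integrable but not Bochner integrable, such that the multifunction $\Gamma:[0,1]\to cwk(X)$, $\Gamma(t)=\operatorname{conv}\{0,f(t)\}$, has the following property: for each of the six notions "Henstock", "$\mathcal H$", "variationally Henstock", "Pettis", "McShane", "Birkhoff", the multifunction $\Gamma$ is integrable in that sense, but there are no variationally McShane integrable $G:[0,1]\to cb(X)$ and no $g:[0,1]\to X$ integrable in that same sense such that $\Gamma(t)=G(t)+g(t)$ for all $t\in[0,1]$.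 In particular, a $cwk(X)$-valued multifunction integrable in any one of these six senses cannot in general be written as $G+g$ with $G$ variationally McShane integrable and $g$ integrable in the same sense. -/

import Mathlib

open Set MeasureTheory
open scoped Pointwise

/-! Multifunctions on `[0,1]` are maps `Γ : ℝ → Set X` of which only the values on
`Set.Icc 0 1` are ever used; likewise for vector functions `f : ℝ → X` and gauges.
Sums and scalar multiples of sets are Minkowski sums and dilations. -/

namespace MultiIntegral

/-- Tagged partitions `{(I₁,t₁),…,(Iₙ,tₙ)}` of `[0,1]` into non-overlapping nondegenerate closed
intervals `Iᵢ = [ptᵢ, ptᵢ₊₁]`, listed from left to right, with arbitrary tags `tᵢ ∈ [0,1]`. -/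
structure TaggedPartition where
  n : ℕ
  pt : Fin (n + 1) → ℝ
  tag : Fin n → ℝ
  strictMono_pt : StrictMono pt
  pt_zero : pt 0 = 0
  pt_last : pt (Fin.last n) = 1
  tag_mem : ∀ i, tag i ∈ Icc (0 : ℝ) 1

namespace TaggedPartition

/-- Left endpoint of the `i`-th interval. -/
def left (P : TaggedPartition) (i : Fin P.n) : ℝ := P.pt i.castSucc

/-- Right endpoint of the `i`-th interval. -/
def right (P : TaggedPartition) (i : Fin P.n) : ℝ := P.pt i.succ

/-- Length of the `i`-th interval. -/
def len (P : TaggedPartition) (i : Fin P.n) : ℝ := P.right i - P.left i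

/-- Perron partitions: each tag lies in its own interval. -/
def IsPerron (P : TaggedPartition) : Prop :=
  ∀ i, P.tag i ∈ Icc (P.left i) (P.right i)

/-- `δ`-fineness: `Iᵢ ⊆ [tᵢ - δ(tᵢ), tᵢ + δ(tᵢ)]` for all `i`. -/
def IsFine (P : TaggedPartition) (δ : ℝ → ℝ) : Prop :=
  ∀ i, Icc (P.left i) (P.right i) ⊆
    Icc (P.tag i - δ (P.tag i)) (P.tag i + δ (P.tag i))

end TaggedPartition

/-- Gauges on `[0,1]`: arbitrary positive functions. -/
def IsGauge (δ : ℝ → ℝ) : Prop := ∀ t ∈ Icc (0 : ℝ) 1, 0 < δ t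

/-- Lebesgue measurable gauges on `[0,1]`. -/
def IsMeasurableGauge (δ : ℝ → ℝ) : Prop :=
  IsGauge δ ∧ NullMeasurable δ (volume.restrict (Icc (0 : ℝ) 1))

section

variable {X : Type*} [NormedAddCommGroup X] [NormedSpace ℝ X]

/-- `cb(X)`: nonempty closed convex bounded sets. -/
def IsCB (A : Set X) : Prop :=
  A.Nonempty ∧ Convex ℝ A ∧ IsClosed A ∧ Bornology.IsBounded A

/-- `cwk(X)`: nonempty closed convex weakly compact sets. -/
def IsCWK (A : Set X) : Prop :=
  A.Nonempty ∧ Convex ℝ A ∧ IsClosed A ∧ IsCompact (toWeakSpace ℝ X '' A)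

/-- The support function `s(φ, C) = sup {φ x : x ∈ C}` (used for bounded nonempty `C`). -/
noncomputable def supportFn (φ : StrongDual ℝ X) (C : Set X) : ℝ := sSup (φ '' C)

/-- The Riemann sum `∑ᵢ Γ(tᵢ) λ(Iᵢ)`. -/
noncomputable def riemannSum (Γ : ℝ → Set X) (P : TaggedPartition) : Set X :=
  ∑ i, P.len i • Γ (P.tag i)

/-- `Φ` is the Henstock integral of `Γ` over `[0,1]`. -/
def HasHenstockIntegral (Γ : ℝ → Set X) (Φ : Set X) : Prop :=
  IsCB Φ ∧ ∀ ε > 0, ∃ δ : ℝ → ℝ, IsGauge δ ∧ ∀ P : TaggedPartition,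
    P.IsPerron → P.IsFine δ → Metric.hausdorffDist Φ (riemannSum Γ P) < ε

/-- `Φ` is the McShane integral of `Γ` over `[0,1]`: the tags need not lie in their intervals. -/
def HasMcShaneIntegral (Γ : ℝ → Set X) (Φ : Set X) : Prop :=
  IsCB Φ ∧ ∀ ε > 0, ∃ δ : ℝ → ℝ, IsGauge δ ∧ ∀ P : TaggedPartition,
    P.IsFine δ → Metric.hausdorffDist Φ (riemannSum Γ P) < ε

/-- `Φ` is the `ℋ`-integral of `Γ` over `[0,1]`: Henstock with measurable gauges. -/
def HasMeasurableHenstockIntegral (Γ : ℝ → Set X) (Φ : Set X) : Prop :=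
  IsCB Φ ∧ ∀ ε > 0, ∃ δ : ℝ → ℝ, IsMeasurableGauge δ ∧ ∀ P : TaggedPartition,
    P.IsPerron → P.IsFine δ → Metric.hausdorffDist Φ (riemannSum Γ P) < ε

/-- `Φ` is the Birkhoff integral of `Γ` over `[0,1]`: McShane with measurable gauges. -/
def HasBirkhoffIntegral (Γ : ℝ → Set X) (Φ : Set X) : Prop :=
  IsCB Φ ∧ ∀ ε > 0, ∃ δ : ℝ → ℝ, IsMeasurableGauge δ ∧ ∀ P : TaggedPartition,
    P.IsFine δ → Metric.hausdorffDist Φ (riemannSum Γ P) < ε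

/-- Variational Henstock integrability. Here `Φ a b` is the integral of `Γ` over `[a,b]`, that is,
the integral over `[0,1]` of `Γ χ_[a,b]`, equal to `Γ` on `[a,b]` and to `0 = {0}` elsewhere. -/
def VariationallyHenstockIntegrable (Γ : ℝ → Set X) : Prop :=
  ∃ Φ : ℝ → ℝ → Set X,
    (∀ a b, 0 ≤ a → a < b → b ≤ 1 →
      HasHenstockIntegral ((Icc a b).indicator Γ) (Φ a b)) ∧
    ∀ ε > 0, ∃ δ : ℝ → ℝ, IsGauge δ ∧ ∀ P : TaggedPartition,
      P.IsPerron → P.IsFine δ →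
        ∑ i, Metric.hausdorffDist (Φ (P.left i) (P.right i)) (P.len i • Γ (P.tag i)) < ε

/-- Variational McShane integrability. -/
def VariationallyMcShaneIntegrable (Γ : ℝ → Set X) : Prop :=
  ∃ Φ : ℝ → ℝ → Set X,
    (∀ a b, 0 ≤ a → a < b → b ≤ 1 →
      HasMcShaneIntegral ((Icc a b).indicator Γ) (Φ a b)) ∧
    ∀ ε > 0, ∃ δ : ℝ → ℝ, IsGauge δ ∧ ∀ P : TaggedPartition,
      P.IsFine δ →
        ∑ i, Metric.hausdorffDist (Φ (P.left i) (P.right i)) (P.len i • Γ (P.tag i)) < ε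

/-- Pettis integrability in `cwk(X)`: `Γ` is scalarly integrable and every Lebesgue measurable
`A ⊆ [0,1]` has an integral `M ∈ cwk(X)`, `s(φ, M) = ∫_A s(φ, Γ)` for all `φ ∈ X*`. -/
def PettisIntegrable (Γ : ℝ → Set X) : Prop :=
  (∀ φ : StrongDual ℝ X, IntegrableOn (fun t => supportFn φ (Γ t)) (Icc (0 : ℝ) 1)) ∧
  ∀ A : Set ℝ, A ⊆ Icc (0 : ℝ) 1 → NullMeasurableSet A →
    ∃ M : Set X, IsCWK M ∧
      ∀ φ : StrongDual ℝ X, supportFn φ M = ∫ t in A, supportFn φ (Γ t)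

end

/-- The six kinds of integrability considered. -/
inductive Kind where
  | henstock
  | measurableHenstock
  | variationalHenstock
  | pettis
  | mcShane
  | birkhoff

section

variable {X : Type*} [NormedAddCommGroup X] [NormedSpace ℝ X]

/-- Integrability of the given kind for multifunctions on `[0,1]`. -/
def Kind.Integrable (k : Kind) (Γ : ℝ → Set X) : Prop :=
  match k with
  | .henstock => ∃ Φ, HasHenstockIntegral Γ Φ
  | .measurableHenstock => ∃ Φ, HasMeasurableHenstockIntegral Γ Φ
  | .variationalHenstock => VariationallyHenstockIntegrable Γ
  | .pettis => PettisIntegrable Γ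
  | .mcShane => ∃ Φ, HasMcShaneIntegral Γ Φ
  | .birkhoff => ∃ Φ, HasBirkhoffIntegral Γ Φ

/-- Integrability of the given kind for `X`-valued functions, viewed as multifunctions with
one-point values (the integral is then itself a one-point set). -/
def Kind.IntegrableFun (k : Kind) (f : ℝ → X) : Prop :=
  k.Integrable (fun t => ({f t} : Set X))

end

end MultiIntegral

/-! Take `X = ℓ²` and `f = n • e_n` on `(1/(n+1), 1/n]`, `f 0 = 0`. The integral of `f` over the
`n`-th piece is `e_n/(n+1)`. These vectors are square summable, so `f` has a Birkhoff integral over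
every measurable set. But `‖f t‖` is comparable with `1/t`, so `f` is not Bochner integrable.

Since `f t` is a nonnegative multiple of a unit vector, `conv {0, f t}` is the order interval `box
(f t)`. On the positive cone `box` is additive (Riesz decomposition), positively homogeneous and
nonexpansive for the Hausdorff distance, so it carries Riemann sums and error estimates for `f` to
those for `Γ`. The singleton map has the same properties, so `IsConeEmbedding` treats `f` and `Γ`
together. Birkhoff integrability (`exists_measurableGauge_norm_sub_sum_lt`) yields the McShane,
Henstock and `ℋ` notions; the variational Henstock and Pettis cases have their own estimates.

The obstruction to `Γ = G + g` lies in `G` alone, so it serves all six notions. `G 0` is a point,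
while `G t` contains two points `f t` apart. With free tags, every interval near `0` may be tagged
by `0`. Comparing this tagging with an ordinary one bounds `∑ λ(I_i) ‖f(t_i)‖` near `0`, although
these sums behave like the divergent integral of `1/t`. -/

namespace MultiIntegral

/-! ### Order intervals in `ℓ²` as a cone embedding -/

/-- The real sequence space `ℓ²`. -/
abbrev SeqSpace : Type := lp (fun _ : ℕ => ℝ) 2

/-- Coordinatewise nonnegative sequences. -/
def IsNonneg (c : SeqSpace) : Prop := ∀ n, 0 ≤ c n

/-- The order interval between `0` and `c`. -/
def box (c : SeqSpace) : Set SeqSpace := {x | ∀ n, x n ∈ Icc 0 (c n)}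

/-- Additive, positively homogeneous, nonexpansive maps from the positive cone of `ℓ²` to weakly
compact convex sets whose support functions are given by coordinatewise weights. -/
structure IsConeEmbedding (j : SeqSpace → Set SeqSpace) : Prop where
  map_zero : j 0 = 0
  map_add : ∀ c d, IsNonneg c → IsNonneg d → j (c + d) = j c + j d
  map_smul : ∀ r : ℝ, ∀ c, 0 ≤ r → IsNonneg c → j (r • c) = r • j c
  hausdorffDist_le : ∀ c d, IsNonneg c → IsNonneg d → Metric.hausdorffDist (j c) (j d) ≤ ‖c - d‖
  isCB : ∀ c, IsNonneg c → IsCB (j c)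
  isCWK : ∀ c, IsNonneg c → IsCWK (j c)
  hasSum_supportFn : ∀ φ : StrongDual ℝ SeqSpace, ∃ w : ℕ → ℝ, ∀ c, IsNonneg c →
    HasSum (fun n => w n * c n) (supportFn φ (j c))

theorem IsNonneg.zero : IsNonneg 0 := fun _ => le_rfl

theorem IsNonneg.add {c d : SeqSpace} (hc : IsNonneg c) (hd : IsNonneg d) : IsNonneg (c + d) :=
  fun n => add_nonneg (hc n) (hd n)

theorem IsNonneg.smul {r : ℝ} {c : SeqSpace} (hr : 0 ≤ r) (hc : IsNonneg c) : IsNonneg (r • c) :=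
  fun n => mul_nonneg hr (hc n)

theorem IsNonneg.sum {ι : Type*} {s : Finset ι} {c : ι → SeqSpace} (hc : ∀ i ∈ s, IsNonneg (c i)) :
    IsNonneg (∑ i ∈ s, c i) := by
  classical
  induction s using Finset.induction_on with
  | empty => exact IsNonneg.zero
  | insert a s ha ih =>
    rw [Finset.sum_insert ha]
    exact (hc a (Finset.mem_insert_self _ _)).add
      (ih fun i hi => hc i (Finset.mem_insert_of_mem hi))

theorem isNonneg_single (n : ℕ) {a : ℝ} (ha : 0 ≤ a) : IsNonneg (lp.single 2 n a) := by
  intro m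
  rw [lp.single_apply, Pi.single_apply]
  split_ifs <;> simp [ha]

theorem IsConeEmbedding.map_sum {j : SeqSpace → Set SeqSpace} (hj : IsConeEmbedding j)
    {ι : Type*} (s : Finset ι) (c : ι → SeqSpace) (hc : ∀ i ∈ s, IsNonneg (c i)) :
    j (∑ i ∈ s, c i) = ∑ i ∈ s, j (c i) := by
  classical
  induction s using Finset.induction_on with
  | empty => simpa using hj.map_zero
  | insert a s ha ih =>
    have hs : ∀ i ∈ s, IsNonneg (c i) := fun i hi => hc i (Finset.mem_insert_of_mem hi)
    rw [Finset.sum_insert ha, Finset.sum_insert ha,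
      hj.map_add _ _ (hc a (Finset.mem_insert_self _ _)) (IsNonneg.sum hs), ih hs]

theorem hasSum_dual_apply (φ : StrongDual ℝ SeqSpace) (c : SeqSpace) :
    HasSum (fun n => φ (lp.single 2 n 1) * c n) (φ c) := by
  have h := (lp.hasSum_single (E := fun _ : ℕ => ℝ) (p := 2) (by norm_num) c).mapL φ
  refine h.congr_fun fun n => ?_
  have : lp.single (E := fun _ : ℕ => ℝ) 2 n (c n) = c n • lp.single (E := fun _ : ℕ => ℝ) 2 n (1 : ℝ) := by
    rw [← lp.single_smul]; simp
  rw [this, map_smul, smul_eq_mul, mul_comm]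

/-- The sequence with coordinates `y n` truncated to `[0, c n]`. -/
def truncate (c : SeqSpace) (y : ℕ → ℝ) : SeqSpace :=
  ⟨fun n => max 0 (min (y n) (c n)), by
    refine (lp.memℓp c).mono' fun n => ?_
    rw [Real.norm_eq_abs, Real.norm_eq_abs, abs_of_nonneg (le_max_left _ _)]
    exact max_le (abs_nonneg _) ((min_le_right _ _).trans (le_abs_self _))⟩

theorem truncate_apply (c : SeqSpace) (y : ℕ → ℝ) (n : ℕ) :
    truncate c y n = max 0 (min (y n) (c n)) := rfl

theorem truncate_mem_box {c : SeqSpace} (hc : IsNonneg c) (y : ℕ → ℝ) : truncate c y ∈ box c :=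
  fun n => ⟨le_max_left _ _, max_le (hc n) (min_le_right _ _)⟩

theorem truncate_of_mem_box {c x : SeqSpace} (hx : x ∈ box c) : truncate c x = x := by
  apply lp.ext
  funext n
  rw [truncate_apply, min_eq_left (hx n).2, max_eq_right (hx n).1]

theorem box_eq_range_truncate {c : SeqSpace} (hc : IsNonneg c) :
    box c = truncate c '' (univ.pi fun n => Icc 0 (c n)) := by
  apply Subset.antisymm
  · exact fun x hx => ⟨x, fun n _ => hx n, truncate_of_mem_box hx⟩
  · rintro _ ⟨y, -, rfl⟩
    exact truncate_mem_box hc y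

/-- Each functional of the truncation is a series of continuous functions of single coordinates,
dominated by `|φ(e_n) c_n|` uniformly in `y`. Order intervals are thus weakly continuous images of
products of compact intervals, hence weakly compact by Tychonoff. -/
theorem continuous_toWeakSpace_truncate (c : SeqSpace) (hc : IsNonneg c) :
    Continuous fun y : ℕ → ℝ => toWeakSpace ℝ SeqSpace (truncate c y) := by
  apply WeakBilin.continuous_of_continuous_eval
  intro φ
  change Continuous fun y : ℕ → ℝ => φ (truncate c y)
  have h : (fun y : ℕ → ℝ => φ (truncate c y)) =
      fun y => ∑' n, φ (lp.single 2 n 1) * truncate c y n :=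
    funext fun y => (hasSum_dual_apply φ _).tsum_eq.symm
  rw [h]
  refine continuous_tsum (u := fun n => |φ (lp.single 2 n 1) * c n|) ?_
    (hasSum_dual_apply φ c).summable.abs ?_
  · intro n
    simp only [truncate_apply]
    fun_prop
  · intro n y
    rw [Real.norm_eq_abs, abs_mul, abs_mul]
    gcongr
    · rw [truncate_apply]; exact le_max_left _ _
    · exact ((truncate_mem_box hc y) n).2

theorem isCompact_toWeakSpace_box {c : SeqSpace} (hc : IsNonneg c) :
    IsCompact (toWeakSpace ℝ SeqSpace '' box c) := by
  rw [box_eq_range_truncate hc, image_image]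
  exact (isCompact_univ_pi fun _ => isCompact_Icc).image (continuous_toWeakSpace_truncate c hc)

theorem norm_le_of_abs_le {x y : SeqSpace} (h : ∀ n, |x n| ≤ |y n|) : ‖x‖ ≤ ‖y‖ :=
  lp.norm_mono (by norm_num) h

theorem isClosed_box (c : SeqSpace) : IsClosed (box c) := by
  have : box c = ⋂ n, (fun x : SeqSpace => x n) ⁻¹' Icc 0 (c n) := by
    ext x; simp [box]
  rw [this]
  exact isClosed_iInter fun n => isClosed_Icc.preimage
    (lp.lipschitzWith_one_eval (E := fun _ : ℕ => ℝ) 2 n).continuous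

theorem convex_box (c : SeqSpace) : Convex ℝ (box c) := by
  intro x hx y hy a b ha hb hab n
  exact convex_Icc 0 (c n) (hx n) (hy n) ha hb hab

theorem isBounded_box (c : SeqSpace) : Bornology.IsBounded (box c) := by
  refine (Metric.isBounded_closedBall (x := (0 : SeqSpace)) (r := ‖c‖)).subset fun x hx => ?_
  rw [mem_closedBall_zero_iff]
  refine norm_le_of_abs_le fun n => ?_
  rw [abs_of_nonneg (hx n).1]
  exact (hx n).2.trans (le_abs_self _)

theorem zero_mem_box {c : SeqSpace} (hc : IsNonneg c) : (0 : SeqSpace) ∈ box c :=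
  fun n => ⟨le_rfl, hc n⟩

/-- Riesz decomposition: `x` splits as `min x c` plus a remainder in `[0, d]`. -/
theorem box_add {c d : SeqSpace} (hc : IsNonneg c) (hd : IsNonneg d) :
    box (c + d) = box c + box d := by
  ext x
  rw [Set.mem_add]
  constructor
  · intro hx
    refine ⟨truncate c x, truncate_mem_box hc _, x - truncate c x, fun n => ?_, by abel⟩
    have h := hx n
    have hcd : (c + d) n = c n + d n := rfl
    have hs : (x - truncate c x) n = x n - max 0 (min (x n) (c n)) := rfl
    rw [hcd] at h
    have h1 := hd n
    rw [hs, max_eq_right (le_min h.1 (hc n))]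
    rcases min_cases (x n) (c n) with h2 | h2 <;> constructor <;> linarith [h.2]
  · rintro ⟨y, hy, z, hz, rfl⟩ n
    exact ⟨add_nonneg (hy n).1 (hz n).1, add_le_add (hy n).2 (hz n).2⟩

theorem box_zero : box 0 = 0 := by
  ext x
  rw [Set.mem_zero]
  constructor
  · intro hx
    apply lp.ext
    funext n
    exact le_antisymm (hx n).2 (hx n).1
  · rintro rfl
    exact zero_mem_box IsNonneg.zero

theorem box_smul {r : ℝ} {c : SeqSpace} (hr : 0 ≤ r) (hc : IsNonneg c) :
    box (r • c) = r • box c := by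
  rcases hr.eq_or_lt with rfl | hr
  · rw [zero_smul, box_zero, zero_smul_set ⟨0, zero_mem_box hc⟩]
  ext x
  rw [Set.mem_smul_set_iff_inv_smul_mem₀ hr.ne']
  refine forall_congr' fun n => ?_
  have h1 : (r • c) n = r * c n := rfl
  have h2 : (r⁻¹ • x) n = r⁻¹ * x n := rfl
  rw [h1, h2, mem_Icc, mem_Icc, inv_mul_le_iff₀ hr, mul_nonneg_iff_of_pos_left (inv_pos.2 hr)]

theorem exists_mem_box_dist_le {c d x : SeqSpace} (hd : IsNonneg d) (hx : x ∈ box c) :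
    ∃ y ∈ box d, dist x y ≤ ‖c - d‖ := by
  refine ⟨truncate d x, truncate_mem_box hd _, ?_⟩
  rw [dist_eq_norm]
  refine norm_le_of_abs_le fun n => ?_
  have hs : (x - truncate d x) n = x n - max 0 (min (x n) (d n)) := rfl
  have ht : (c - d) n = c n - d n := rfl
  have h := hx n
  rw [hs, ht, max_eq_right (le_min h.1 (hd n))]
  rcases min_cases (x n) (d n) with h2 | h2
  · rw [h2.1, sub_self, abs_zero]; exact abs_nonneg _
  · rw [h2.1, abs_of_nonneg (by linarith)]
    exact (sub_le_sub_right h.2 _).trans (le_abs_self _)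

/-- The maximum is attained at the vertex that keeps `c n` exactly where `φ(e_n) ≥ 0`. The weights
are therefore the positive parts of `φ(e_n)`, the same for all `c`. -/
theorem isGreatest_image_box (φ : StrongDual ℝ SeqSpace) {c : SeqSpace} (hc : IsNonneg c) {s : ℝ}
    (hs : HasSum (fun n => max (φ (lp.single 2 n 1)) 0 * c n) s) : IsGreatest (φ '' box c) s := by
  constructor
  · refine ⟨truncate c fun n => if 0 ≤ φ (lp.single 2 n 1) then c n else 0,
      truncate_mem_box hc _, (hasSum_dual_apply φ _).unique ?_⟩
    refine hs.congr_fun fun n => ?_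
    rw [truncate_apply]
    split_ifs with h
    · rw [min_self, max_eq_right (hc n), max_eq_left h]
    · rw [min_eq_left (hc n), max_self, max_eq_right (not_le.1 h).le, mul_zero, zero_mul]
  · rintro _ ⟨x, hx, rfl⟩
    refine hasSum_le (fun n => ?_) (hasSum_dual_apply φ x) hs
    exact (mul_le_mul_of_nonneg_right (le_max_left _ 0) (hx n).1).trans
      (mul_le_mul_of_nonneg_left (hx n).2 (le_max_right _ _))

theorem isConeEmbedding_box : IsConeEmbedding box where
  map_zero := box_zero
  map_add _ _ := box_add
  map_smul _ _ := box_smul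
  hausdorffDist_le c d hc hd :=
    Metric.hausdorffDist_le_of_mem_dist (norm_nonneg _) (fun _ => exists_mem_box_dist_le hd)
      fun x hx => by
        rw [norm_sub_rev]
        exact exists_mem_box_dist_le hc hx
  isCB c hc := ⟨⟨0, zero_mem_box hc⟩, convex_box c, isClosed_box c, isBounded_box c⟩
  isCWK c hc := ⟨⟨0, zero_mem_box hc⟩, convex_box c, isClosed_box c, isCompact_toWeakSpace_box hc⟩
  hasSum_supportFn φ := by
    refine ⟨fun n => max (φ (lp.single 2 n 1)) 0, fun c hc => ?_⟩
    have h : Summable fun n => max (φ (lp.single 2 n 1)) 0 * c n := by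
      refine (hasSum_dual_apply φ c).summable.abs.of_nonneg_of_le
        (fun n => mul_nonneg (le_max_right _ _) (hc n)) fun n => ?_
      rw [abs_mul, abs_of_nonneg (hc n)]
      exact mul_le_mul_of_nonneg_right (max_le (le_abs_self _) (abs_nonneg _)) (hc n)
    rw [supportFn, (isGreatest_image_box φ hc h.hasSum).csSup_eq]
    exact h.hasSum

theorem isConeEmbedding_singleton : IsConeEmbedding fun c : SeqSpace => {c} where
  map_zero := rfl
  map_add c d _ _ := by rw [singleton_add_singleton]
  map_smul r c _ _ := by rw [smul_set_singleton]
  hausdorffDist_le c d _ _ := by rw [Metric.hausdorffDist_singleton, dist_eq_norm]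
  isCB c _ := ⟨singleton_nonempty _, convex_singleton _, isClosed_singleton,
    Bornology.isBounded_singleton⟩
  isCWK c _ := ⟨singleton_nonempty _, convex_singleton _, isClosed_singleton, by
    rw [image_singleton]; exact isCompact_singleton⟩
  hasSum_supportFn φ := by
    refine ⟨fun n => φ (lp.single 2 n 1), fun c _ => ?_⟩
    rw [supportFn, image_singleton, csSup_singleton]
    exact hasSum_dual_apply φ c

theorem box_single (n : ℕ) {a : ℝ} (ha : 0 ≤ a) :
    box (lp.single 2 n a) = convexHull ℝ {0, lp.single 2 n a} := by
  rw [convexHull_pair]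
  apply Subset.antisymm
  · intro x hx
    have hxn : lp.single (E := fun _ : ℕ => ℝ) 2 n (x n) = x := by
      apply lp.ext
      funext m
      rw [lp.single_apply]
      by_cases hm : m = n
      · subst hm; simp
      · have := hx m
        rw [lp.single_apply_ne _ _ _ hm] at this
        rw [Pi.single_eq_of_ne hm]
        exact le_antisymm this.1 this.2
    have h := hx n
    rw [lp.single_apply_self] at h
    rw [segment_eq_image]
    rcases ha.eq_or_lt with rfl | ha
    · refine ⟨0, by simp, ?_⟩
      rw [← hxn, le_antisymm h.2 h.1]
      simp
    · refine ⟨x n / a, ⟨div_nonneg h.1 ha.le, div_le_one_of_le₀ h.2 ha.le⟩, ?_⟩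
      conv_rhs => rw [← hxn]
      simp only [smul_zero, zero_add]
      rw [← lp.single_smul, smul_eq_mul, div_mul_cancel₀ _ ha.ne']
  · exact (convex_box _).segment_subset (zero_mem_box (isNonneg_single n ha))
      fun m => ⟨isNonneg_single n ha m, le_rfl⟩

end MultiIntegral

/-! ### Tagged partitions and measurable gauges with small excess -/

namespace MultiIntegral

namespace TaggedPartition

variable (P : TaggedPartition)

theorem left_lt_right (i : Fin P.n) : P.left i < P.right i :=
  P.strictMono_pt i.castSucc_lt_succ

theorem len_pos (i : Fin P.n) : 0 < P.len i := sub_pos.2 (P.left_lt_right i)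

theorem left_nonneg (i : Fin P.n) : 0 ≤ P.left i :=
  P.pt_zero ▸ P.strictMono_pt.monotone (Fin.zero_le _)

theorem right_le_one (i : Fin P.n) : P.right i ≤ 1 :=
  P.pt_last ▸ P.strictMono_pt.monotone (Fin.le_last _)

theorem sum_sub_telescope (g : ℝ → ℝ) : ∑ i, (g (P.right i) - g (P.left i)) = g 1 - g 0 := by
  have key : ∀ (n : ℕ) (p : Fin (n + 1) → ℝ),
      ∑ i : Fin n, (g (p i.succ) - g (p i.castSucc)) = g (p (Fin.last n)) - g (p 0) := by
    intro n
    induction n with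
    | zero => intro p; simp
    | succ n ih =>
      intro p
      rw [Fin.sum_univ_castSucc]
      have := ih fun i => p i.castSucc
      simp only [Fin.castSucc_zero] at this
      simp only [Fin.succ_castSucc, Fin.succ_last]
      rw [this]
      ring
  have := key P.n P.pt
  rwa [P.pt_zero, P.pt_last] at this

end TaggedPartition

/-- Written as an increment of a function of the endpoint, the measure telescopes over a partition.
-/
theorem volume_real_Icc_inter_eq_sub {S : Set ℝ} (hS : MeasurableSet S) {a b : ℝ} (ha : 0 ≤ a)
    (hab : a ≤ b) : volume.real (Icc a b ∩ S) =
      volume.real (Ioc 0 b ∩ S) - volume.real (Ioc 0 a ∩ S) := by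
  have h1 : volume.real (Icc a b ∩ S) = volume.real (Ioc a b ∩ S) :=
    measureReal_congr (Ioc_ae_eq_Icc.symm.inter (Filter.EventuallyEq.refl _ _))
  have h2 : Ioc 0 b ∩ S = (Ioc 0 a ∩ S) ∪ (Ioc a b ∩ S) := by
    rw [← union_inter_distrib_right, Ioc_union_Ioc_eq_Ioc ha hab]
  have h3 : Disjoint (Ioc 0 a ∩ S) (Ioc a b ∩ S) :=
    (Ioc_disjoint_Ioc_of_le le_rfl).mono inter_subset_left inter_subset_left
  have f1 : volume (Ioc 0 a ∩ S) ≠ ⊤ := measure_ne_top_of_subset inter_subset_left (by simp)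
  have f2 : volume (Ioc a b ∩ S) ≠ ⊤ := measure_ne_top_of_subset inter_subset_left (by simp)
  rw [h1, h2, measureReal_union h3 (measurableSet_Ioc.inter hS) f1 f2]
  ring

namespace TaggedPartition

variable (P : TaggedPartition)

theorem sum_volume_real_inter {S : Set ℝ} (hS : MeasurableSet S) :
    ∑ i, volume.real (Icc (P.left i) (P.right i) ∩ S) = volume.real (Icc 0 1 ∩ S) := by
  rw [volume_real_Icc_inter_eq_sub hS le_rfl zero_le_one,
    ← P.sum_sub_telescope fun x => volume.real (Ioc 0 x ∩ S)]
  exact Finset.sum_congr rfl fun i _ =>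
    volume_real_Icc_inter_eq_sub hS (P.left_nonneg i) (P.left_lt_right i).le

theorem len_eq (i : Fin P.n) : P.len i = volume.real (Icc (P.left i) (P.right i)) := by
  rw [Real.volume_real_Icc_of_le (P.left_lt_right i).le, len]

theorem len_eq_add {S : Set ℝ} (hS : MeasurableSet S) (i : Fin P.n) :
    P.len i = volume.real (Icc (P.left i) (P.right i) ∩ S) +
      volume.real (Icc (P.left i) (P.right i) \ S) := by
  rw [P.len_eq, measureReal_inter_add_sdiff hS (by simp)]

theorem Icc_subset (i : Fin P.n) : Icc (P.left i) (P.right i) ⊆ Icc 0 1 :=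
  Icc_subset_Icc (P.left_nonneg i) (P.right_le_one i)

end TaggedPartition

theorem measurable_infDist_comp_nat {N : ℝ → ℕ} (hN : Measurable N) (F : ℕ → Set ℝ) :
    Measurable fun t => Metric.infDist t (F (N t)) := by
  intro s hs
  have h : (fun t => Metric.infDist t (F (N t))) ⁻¹' s =
      ⋃ n, N ⁻¹' {n} ∩ (fun t => Metric.infDist t (F n)) ⁻¹' s := by
    ext t
    simp
  rw [h]
  exact MeasurableSet.iUnion fun n =>
    (hN (measurableSet_singleton n)).inter (measurable_infDist hs)

/-- A measurable gauge for which intervals with tag in a level set of `N` stay in a prescribed open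
neighbourhood and together exceed that level set by at most a prescribed amount. -/
theorem exists_measurableGauge_sum_excess_le {N : ℝ → ℕ} (hN : Measurable N) {η : ℕ → ℝ}
    (hη : ∀ n, 0 < η n) {V : ℕ → Set ℝ} (hV : ∀ n, IsOpen (V n))
    (hNV : ∀ t ∈ Icc (0 : ℝ) 1, t ∈ V (N t)) :
    ∃ δ, IsMeasurableGauge δ ∧ ∀ P : TaggedPartition, P.IsFine δ →
      (∀ i, Icc (P.left i) (P.right i) ⊆ V (N (P.tag i))) ∧
      ∀ n, ∑ i with N (P.tag i) = n,
        volume.real (Icc (P.left i) (P.right i) \ N ⁻¹' {n}) ≤ η n := by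
  have hE : ∀ n, MeasurableSet (Icc (0 : ℝ) 1 ∩ N ⁻¹' {n}) := fun n =>
    measurableSet_Icc.inter (hN (measurableSet_singleton n))
  -- Outer regularity of each level set. The bound by `(-1, 2)` keeps measures finite and
  -- complements nonempty.
  have hU : ∀ n, ∃ U, IsOpen U ∧ Icc (0 : ℝ) 1 ∩ N ⁻¹' {n} ⊆ U ∧ U ⊆ V n ∧ U ⊆ Ioo (-1) 2 ∧
      volume.real (U \ (Icc (0 : ℝ) 1 ∩ N ⁻¹' {n})) ≤ η n := by
    intro n
    obtain ⟨U, hEU, hU, -, hlt⟩ := (hE n).exists_isOpen_sdiff_lt (μ := volume)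
      (measure_ne_top_of_subset inter_subset_left (by simp))
      (ε := ENNReal.ofReal (η n)) (by simpa using hη n)
    refine ⟨U ∩ (V n ∩ Ioo (-1) 2), hU.inter ((hV n).inter isOpen_Ioo), fun t ht => ?_,
      fun t ht => ht.2.1, fun t ht => ht.2.2, ?_⟩
    · have h2 : N t = n := ht.2
      exact ⟨hEU ht, h2 ▸ hNV t ht.1, by linarith [ht.1.1], by linarith [ht.1.2]⟩
    · rw [Measure.real]
      refine ENNReal.toReal_le_of_le_ofReal (hη n).le ((measure_mono ?_).trans hlt.le)
      exact sdiff_subset_sdiff_left inter_subset_left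
  choose U hUo hEU hUV hUb hUη using hU
  have hne : ∀ n, (U n)ᶜ.Nonempty := fun n => ⟨2, fun h => by have := (hUb n h).2; linarith⟩
  -- Half the distance to the complement keeps the closed interval inside `U`; it is measurable
  -- because `N` takes countably many values.
  set δ : ℝ → ℝ := fun t => Metric.infDist t (U (N t))ᶜ / 2 with hδ
  have hpos : ∀ t ∈ Icc (0 : ℝ) 1, 0 < Metric.infDist t (U (N t))ᶜ := by
    intro t ht
    refine ((hUo _).isClosed_compl.notMem_iff_infDist_pos (hne _)).1 ?_
    rw [notMem_compl_iff]
    exact hEU _ ⟨ht, rfl⟩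
  have hsub : ∀ t ∈ Icc (0 : ℝ) 1, Icc (t - δ t) (t + δ t) ⊆ U (N t) := by
    intro t ht x hx
    by_contra hxU
    have h1 : Metric.infDist t (U (N t))ᶜ ≤ dist t x := Metric.infDist_le_dist_of_mem hxU
    have h2 : dist t x ≤ δ t := by
      rw [Real.dist_eq, abs_le]
      constructor <;> linarith [hx.1, hx.2]
    have h3 := hpos t ht
    simp only [hδ] at h2
    linarith
  refine ⟨δ, ⟨fun t ht => half_pos (hpos t ht), ?_⟩, fun P hP => ?_⟩
  · exact ((measurable_infDist_comp_nat hN fun n => (U n)ᶜ).div_const 2).nullMeasurable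
  have hI : ∀ i, Icc (P.left i) (P.right i) ⊆ U (N (P.tag i)) := fun i =>
    (hP i).trans (hsub _ (P.tag_mem i))
  refine ⟨fun i => (hI i).trans (hUV _), fun n => ?_⟩
  have hm : MeasurableSet (U n \ (Icc (0 : ℝ) 1 ∩ N ⁻¹' {n})) := (hUo n).measurableSet.diff (hE n)
  calc ∑ i with N (P.tag i) = n, volume.real (Icc (P.left i) (P.right i) \ N ⁻¹' {n})
      ≤ ∑ i with N (P.tag i) = n,
        volume.real (Icc (P.left i) (P.right i) ∩ (U n \ (Icc (0 : ℝ) 1 ∩ N ⁻¹' {n}))) := by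
        refine Finset.sum_le_sum fun i hi => measureReal_mono ?_
          (measure_ne_top_of_subset inter_subset_left (by simp))
        have hi : N (P.tag i) = n := (Finset.mem_filter.1 hi).2
        exact fun x hx => ⟨hx.1, hi ▸ hI i hx.1, fun h => hx.2 h.2⟩
    _ ≤ ∑ i, volume.real (Icc (P.left i) (P.right i) ∩ (U n \ (Icc (0 : ℝ) 1 ∩ N ⁻¹' {n}))) :=
        Finset.sum_le_sum_of_subset_of_nonneg (Finset.filter_subset _ _)
          fun _ _ _ => measureReal_nonneg
    _ = volume.real (Icc 0 1 ∩ (U n \ (Icc (0 : ℝ) 1 ∩ N ⁻¹' {n}))) := P.sum_volume_real_inter hm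
    _ ≤ volume.real (U n \ (Icc (0 : ℝ) 1 ∩ N ⁻¹' {n})) :=
        measureReal_mono inter_subset_right (measure_ne_top_of_subset
          (sdiff_subset.trans (hUb n)) (by simp))
    _ ≤ η n := hUη n

/-- Weighted form of the total excess, with summable budget. -/
theorem sum_excess_le {N : ℝ → ℕ} (P : TaggedPartition) {η C : ℕ → ℝ} (hC : ∀ n, 0 ≤ C n)
    (h : ∀ n, ∑ i with N (P.tag i) = n,
      volume.real (Icc (P.left i) (P.right i) \ N ⁻¹' {n}) ≤ η n)
    {θ : ℝ} (hη : ∀ n, C n * η n ≤ θ / 2 / 2 ^ n) (hθ : 0 ≤ θ) :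
    ∑ i, C (N (P.tag i)) *
      volume.real (Icc (P.left i) (P.right i) \ N ⁻¹' {N (P.tag i)}) ≤ θ := by
  rw [← Finset.sum_fiberwise_of_maps_to
    (fun i _ => Finset.mem_image_of_mem (fun i => N (P.tag i)) (Finset.mem_univ i))]
  calc _ ≤ ∑ n ∈ Finset.univ.image fun i => N (P.tag i), θ / 2 / 2 ^ n := by
        refine Finset.sum_le_sum fun n _ => ?_
        refine le_trans (le_of_eq ?_) ((mul_le_mul_of_nonneg_left (h n) (hC n)).trans (hη n))
        rw [Finset.mul_sum]
        exact Finset.sum_congr rfl fun i hi => by rw [(Finset.mem_filter.1 hi).2]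
    _ ≤ ∑' n, θ / 2 / 2 ^ n := (summable_geometric_two' θ).sum_le_tsum _ fun n _ => by positivity
    _ = θ := tsum_geometric_two' θ

end MultiIntegral

/-! ### Birkhoff integrability of countably valued functions in `ℓ²` -/

namespace MultiIntegral

theorem memℓp_inv_natCast_add_one : Memℓp (fun n : ℕ => ((n : ℝ) + 1)⁻¹) 2 := by
  refine memℓp_gen ?_
  have h : Summable fun n : ℕ => (((n + 1 : ℕ) : ℝ) ^ 2)⁻¹ :=
    (summable_nat_add_iff 1).2 (Real.summable_nat_pow_inv.2 one_lt_two)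
  refine h.congr fun n => ?_
  rw [Real.norm_eq_abs, abs_of_nonneg (by positivity)]
  simp

theorem exists_pos_forall_mul_le (s : Finset ℕ) (a : ℕ → ℝ) {κ : ℕ → ℝ} (hκ : ∀ n, 0 < κ n) :
    ∃ θ > 0, ∀ n ∈ s, a n * θ ≤ κ n := by
  have h : ∀ᶠ θ in nhdsWithin (0 : ℝ) (Ioi 0), ∀ n ∈ s, a n * θ ≤ κ n := by
    rw [Filter.eventually_all_finset]
    intro n _
    have : Filter.Tendsto (fun θ : ℝ => a n * θ) (nhdsWithin 0 (Ioi 0)) (nhds (a n * 0)) :=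
      ((continuous_const.mul continuous_id).tendsto 0).mono_left nhdsWithin_le_nhds
    rw [mul_zero] at this
    exact (this.eventually_lt_const (hκ n)).mono fun _ => le_of_lt
  obtain ⟨θ, h1, h2⟩ := (h.and self_mem_nhdsWithin).exists
  exact ⟨θ, h2, h1⟩

theorem sub_sum_single_apply (z : SeqSpace) (s : Finset ℕ) (n : ℕ) :
    (z - ∑ m ∈ s, lp.single 2 m (z m)) n = if n ∈ s then 0 else z n := by
  have h : (z - ∑ m ∈ s, lp.single 2 m (z m)) n =
      z n - (∑ m ∈ s, lp.single (E := fun _ : ℕ => ℝ) 2 m (z m)) n := rfl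
  rw [h, lp.coeFn_sum, Finset.sum_apply]
  simp only [lp.single_apply, Pi.single_apply]
  rw [Finset.sum_ite_eq]
  split_ifs <;> simp

/-- A vector function with values `a n • e n` on measurable sets `N ⁻¹' {n}` is Birkhoff integrable
as soon as the vector of its scalar integrals belongs to `ℓ²`. -/
theorem exists_measurableGauge_norm_sub_sum_lt {N : ℝ → ℕ} (hN : Measurable N) {a : ℕ → ℝ}
    (ha : ∀ n, 0 ≤ a n) {z : SeqSpace}
    (hz : ∀ n, z n = a n * volume.real (Icc 0 1 ∩ N ⁻¹' {n})) {ε : ℝ} (hε : 0 < ε) :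
    ∃ δ, IsMeasurableGauge δ ∧ ∀ P : TaggedPartition, P.IsFine δ →
      ‖z - ∑ i, P.len i • lp.single 2 (N (P.tag i)) (a (N (P.tag i)))‖ < ε := by
  obtain ⟨k, hk⟩ : ∃ k : SeqSpace, ∀ n, 0 < k n :=
    ⟨⟨_, memℓp_inv_natCast_add_one⟩, fun n => by
      change 0 < ((n : ℝ) + 1)⁻¹
      positivity⟩
  have hk1 : 0 < ‖k‖ + 1 := by positivity
  -- `σ • k` is a strictly positive error budget for all coordinates at once, of norm below `ε / 2`;
  -- the other half of `ε` pays for the tail of `z` outside a finite set `s`.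
  set σ : ℝ := ε / 2 / (‖k‖ + 1) with hσ
  have hσpos : 0 < σ := by positivity
  have hσk : ‖σ • k‖ < ε / 2 := by
    rw [norm_smul, Real.norm_eq_abs, abs_of_pos hσpos, hσ, div_mul_eq_mul_div,
      div_lt_iff₀ hk1]
    nlinarith
  obtain ⟨s, hs⟩ : ∃ s : Finset ℕ, ‖z - ∑ m ∈ s, lp.single 2 m (z m)‖ < ε / 2 := by
    have h := lp.hasSum_single (E := fun _ : ℕ => ℝ) (p := 2) (by norm_num) z
    obtain ⟨s, hs⟩ := (Metric.tendsto_nhds.1 h (ε / 2) (half_pos hε)).exists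
    exact ⟨s, by rwa [dist_comm, dist_eq_norm] at hs⟩
  have hκ : ∀ n, 0 < σ * k n := fun n => mul_pos hσpos (hk n)
  obtain ⟨θ, hθ, hθs⟩ := exists_pos_forall_mul_le s a hκ
  have ha1 : ∀ n, 0 < a n + 1 := fun n => by linarith [ha n]
  obtain ⟨δ, hδ, hδP⟩ := exists_measurableGauge_sum_excess_le hN
    -- The first bound controls the excess in coordinate `n`, the second makes the total excess at
    -- most `θ`. Using `a n + 1` avoids division by zero.
    (η := fun n => min (σ * k n / (a n + 1)) (θ / 2 / 2 ^ n))
    (fun n => lt_min (div_pos (hκ n) (ha1 n)) (by positivity)) (V := fun _ => univ)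
    (fun _ => isOpen_univ) (fun _ _ => mem_univ _)
  refine ⟨δ, hδ, fun P hP => ?_⟩
  have hex := (hδP P hP).2
  have htot : ∑ i, volume.real (Icc (P.left i) (P.right i) \ N ⁻¹' {N (P.tag i)}) ≤ θ := by
    have := sum_excess_le P (C := fun _ => 1) (fun _ => zero_le_one) hex (θ := θ)
      (fun n => by rw [one_mul]; exact min_le_right _ _) hθ.le
    simpa using this
  set b : SeqSpace := σ • k + (z - ∑ m ∈ s, lp.single 2 m (z m)) with hb
  refine lt_of_le_of_lt (b := ‖b‖) (norm_le_of_abs_le fun n => ?_)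
    ((norm_add_le _ _).trans_lt (by linarith))
  have hbn : b n = σ * k n + if n ∈ s then 0 else z n := by
    rw [← sub_sum_single_apply z s n]; rfl
  have hE : MeasurableSet (N ⁻¹' {n}) := hN (measurableSet_singleton n)
  have hzn : 0 ≤ z n := by rw [hz]; exact mul_nonneg (ha n) measureReal_nonneg
  have hbn0 : 0 ≤ b n := by
    rw [hbn]
    have := hκ n
    split_ifs <;> linarith
  -- `p` is the part of level `n` covered by intervals with other tags, `q` the part outside level
  -- `n` covered by intervals tagged in it. The error in coordinate `n` is `a n * (p - q)`.
  set p : ℝ := ∑ i with ¬ N (P.tag i) = n, volume.real (Icc (P.left i) (P.right i) ∩ N ⁻¹' {n})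
    with hp
  set q : ℝ := ∑ i with N (P.tag i) = n, volume.real (Icc (P.left i) (P.right i) \ N ⁻¹' {n})
    with hq
  set R : SeqSpace := ∑ i, P.len i • lp.single 2 (N (P.tag i)) (a (N (P.tag i))) with hR
  have hsum : (z - R) n =
      a n * p - a n * q := by
    have h1 : (z - R) n = z n - R n := rfl
    have h2 : R n = a n * ∑ i with N (P.tag i) = n, P.len i := by
      rw [hR, lp.coeFn_sum, Finset.sum_apply, Finset.mul_sum, Finset.sum_filter]
      refine Finset.sum_congr rfl fun i _ => ?_
      rw [lp.coeFn_smul, Pi.smul_apply, lp.single_apply, Pi.single_apply, smul_eq_mul]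
      by_cases h : N (P.tag i) = n
      · rw [if_pos h, if_pos h.symm, h, mul_comm]
      · rw [if_neg h, if_neg (Ne.symm h), mul_zero]
    have h3 : ∑ i with N (P.tag i) = n, P.len i =
        (∑ i with N (P.tag i) = n, volume.real (Icc (P.left i) (P.right i) ∩ N ⁻¹' {n})) + q := by
      rw [hq, ← Finset.sum_add_distrib]
      exact Finset.sum_congr rfl fun i _ => P.len_eq_add hE i
    have h4 := Finset.sum_filter_add_sum_filter_not Finset.univ (fun i => N (P.tag i) = n)
      fun i => volume.real (Icc (P.left i) (P.right i) ∩ N ⁻¹' {n})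
    rw [P.sum_volume_real_inter hE] at h4
    rw [h1, h2, h3, hz, ← h4]
    ring
  have hp0 : 0 ≤ p := Finset.sum_nonneg fun _ _ => measureReal_nonneg
  have hq0 : 0 ≤ q := Finset.sum_nonneg fun _ _ => measureReal_nonneg
  have hpz : a n * p ≤ z n := by
    rw [hz, ← P.sum_volume_real_inter hE]
    exact mul_le_mul_of_nonneg_left (Finset.sum_le_sum_of_subset_of_nonneg
      (Finset.filter_subset _ _) fun _ _ _ => measureReal_nonneg) (ha n)
  -- What level `n` loses to other tags is excess of those tags' levels. Hence `a n * p` is at most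
  -- `σ * k n` for `n ∈ s`, and at most `z n` in any case.
  have hpθ : p ≤ θ := by
    refine le_trans (Finset.sum_le_sum fun i hi => ?_)
      ((Finset.sum_le_sum_of_subset_of_nonneg (Finset.filter_subset _ _)
        fun _ _ _ => measureReal_nonneg).trans htot)
    refine measureReal_mono (fun x hx => ⟨hx.1, ?_⟩)
      (measure_ne_top_of_subset sdiff_subset (by simp))
    have h1 : N x = n := hx.2
    have h2 := (Finset.mem_filter.1 hi).2
    exact fun h3 => h2 ((show N x = N (P.tag i) from h3).symm.trans h1)
  have hqκ : a n * q ≤ σ * k n := by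
    have h1 : q ≤ σ * k n / (a n + 1) := (hex n).trans (min_le_left _ _)
    rw [le_div_iff₀ (ha1 n)] at h1
    linarith
  have haq : 0 ≤ a n * q := mul_nonneg (ha n) hq0
  have hap : 0 ≤ a n * p := mul_nonneg (ha n) hp0
  rw [hsum, abs_of_nonneg hbn0, hbn, abs_le]
  have hκn := hκ n
  split_ifs with hns
  · have h1 := hθs n hns
    have h2 := mul_le_mul_of_nonneg_left hpθ (ha n)
    constructor <;> linarith
  · constructor <;> linarith

/-! ### The function `n • e_n` and its primitive -/

/-- The function `⌊1/t⌋`, with value `0` outside `(0,1]`. -/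
noncomputable def level (t : ℝ) : ℕ := ⌊t⁻¹⌋₊

/-- The vector function equal to `n • e n` on `(1/(n+1), 1/n]`. -/
noncomputable def harmonicFun (t : ℝ) : SeqSpace := lp.single 2 (level t) (level t : ℝ)

theorem measurable_level : Measurable level := Nat.measurable_floor.comp measurable_inv

theorem level_zero : level 0 = 0 := by simp [level]

theorem harmonicFun_zero : harmonicFun 0 = 0 := by simp [harmonicFun, level_zero]

theorem isNonneg_harmonicFun (t : ℝ) : IsNonneg (harmonicFun t) :=
  isNonneg_single _ (Nat.cast_nonneg _)

theorem bounds_of_level_eq {t : ℝ} {n : ℕ} (hn : n ≠ 0) (h : level t = n) :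
    0 < t ∧ 1 < (n + 1) * t ∧ n * t ≤ 1 := by
  have hpos : 0 < t⁻¹ := by
    by_contra hneg
    rw [level, Nat.floor_of_nonpos (not_lt.1 hneg)] at h
    exact hn h.symm
  have ht : 0 < t := inv_pos.1 hpos
  obtain ⟨h1, h2⟩ := (Nat.floor_eq_iff hpos.le).1 h
  refine ⟨ht, ?_, ?_⟩
  · have := mul_lt_mul_of_pos_right h2 ht
    rwa [inv_mul_cancel₀ ht.ne'] at this
  · have := mul_le_mul_of_nonneg_right h1 ht.le
    rwa [inv_mul_cancel₀ ht.ne'] at this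

theorem level_pos {t : ℝ} (ht : 0 < t) (ht1 : t ≤ 1) : 0 < level t :=
  Nat.floor_pos.2 ((one_le_inv₀ ht).2 ht1)

theorem inv_le_two_mul_norm_harmonicFun {t : ℝ} (ht : 0 < t) (ht1 : t ≤ 1) :
    t⁻¹ ≤ 2 * ‖harmonicFun t‖ := by
  have h1 : (1 : ℝ) ≤ level t := by exact_mod_cast level_pos ht ht1
  have h2 : t⁻¹ < level t + 1 := Nat.lt_floor_add_one _
  rw [harmonicFun, lp.norm_single (by norm_num), Real.norm_of_nonneg (by linarith)]
  linarith

theorem mul_volume_real_level_le (A : Set ℝ) (n : ℕ) :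
    n * volume.real (Icc 0 1 ∩ A ∩ level ⁻¹' {n}) ≤ ((n : ℝ) + 1)⁻¹ := by
  rcases eq_or_ne n 0 with rfl | hn
  · simp
  have hn' : (0 : ℝ) < n := by positivity
  have h : Icc 0 1 ∩ A ∩ level ⁻¹' {n} ⊆ Icc ((n : ℝ) + 1)⁻¹ (n : ℝ)⁻¹ := by
    intro t ht
    obtain ⟨-, h1, h2⟩ := bounds_of_level_eq hn ht.2
    exact ⟨(inv_le_iff_one_le_mul₀' (by positivity)).2 h1.le, by rw [← one_div, le_div_iff₀' hn']; exact h2⟩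
  have h2 := measureReal_mono h (μ := volume) (by simp)
  rw [Real.volume_real_Icc_of_le (by gcongr; linarith)] at h2
  refine (mul_le_mul_of_nonneg_left h2 hn'.le).trans (le_of_eq ?_)
  field_simp
  ring

/-- The weak integral of `harmonicFun` over `A ∩ [0,1]`. -/
noncomputable def primitive (A : Set ℝ) : SeqSpace :=
  ⟨fun n => n * volume.real (Icc 0 1 ∩ A ∩ level ⁻¹' {n}), by
    refine memℓp_inv_natCast_add_one.mono fun n => ?_
    rw [Real.norm_of_nonneg (by positivity)]
    exact mul_volume_real_level_le A n⟩

theorem primitive_apply (A : Set ℝ) (n : ℕ) :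
    primitive A n = n * volume.real (Icc 0 1 ∩ A ∩ level ⁻¹' {n}) := rfl

theorem isNonneg_primitive (A : Set ℝ) : IsNonneg (primitive A) := fun n => by
  rw [primitive_apply]; positivity

theorem primitive_mono {A B : Set ℝ} (h : A ⊆ B) (n : ℕ) : primitive A n ≤ primitive B n := by
  rw [primitive_apply, primitive_apply]
  refine mul_le_mul_of_nonneg_left (measureReal_mono ?_ ?_) (Nat.cast_nonneg n)
  · exact inter_subset_inter_left _ (inter_subset_inter_right _ h)
  · exact measure_ne_top_of_subset (inter_subset_left.trans inter_subset_left)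
      (by simp : volume (Icc (0 : ℝ) 1) ≠ ⊤)

theorem exists_measurableGauge_harmonicFun {A : Set ℝ} (hA : MeasurableSet A) {ε : ℝ}
    (hε : 0 < ε) : ∃ δ, IsMeasurableGauge δ ∧ ∀ P : TaggedPartition, P.IsFine δ →
      ‖primitive A - ∑ i, P.len i • A.indicator harmonicFun (P.tag i)‖ < ε := by
  -- Points outside `A` are moved to level `0`, whose coefficient vanishes.
  have h := exists_measurableGauge_norm_sub_sum_lt (N := A.indicator level)
    (measurable_level.indicator hA) (a := fun n => n) (fun n => Nat.cast_nonneg n)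
    (z := primitive A) (fun n => ?_) hε
  · convert h using 10 with δ P hP i
    by_cases hi : P.tag i ∈ A
    · simp [hi, harmonicFun]
    · simp [hi]
  · rw [primitive_apply]
    rcases eq_or_ne n 0 with rfl | hn
    · simp
    congr 2
    ext t
    by_cases ht : t ∈ A
    · simp [ht]
    · simp [ht, hn.symm]

/-- For `h < 1/(m+1)` the interval `[0, h]` misses all levels `0 < n < m`, so its primitive is
dominated by a tail of `primitive univ`. -/
theorem exists_norm_primitive_lt {ε : ℝ} (hε : 0 < ε) :
    ∃ ρ > 0, ∀ h < ρ, ‖primitive (Icc 0 h)‖ < ε := by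
  have hs := (lp.hasSum_single (E := fun _ : ℕ => ℝ) (p := 2) (by norm_num)
    (primitive univ)).tendsto_sum_nat
  obtain ⟨m, hm⟩ := (Metric.tendsto_nhds.1 hs ε hε).exists
  rw [dist_comm, dist_eq_norm] at hm
  refine ⟨((m : ℝ) + 1)⁻¹, by positivity, fun h hh => lt_of_le_of_lt ?_ hm⟩
  refine norm_le_of_abs_le fun n => ?_
  rw [sub_sum_single_apply, abs_of_nonneg (isNonneg_primitive _ n)]
  split_ifs with hn
  · rw [primitive_apply, abs_zero]
    rcases eq_or_ne n 0 with rfl | hn0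
    · simp
    have : Icc 0 1 ∩ Icc 0 h ∩ level ⁻¹' {n} = ∅ := by
      rw [Set.eq_empty_iff_forall_notMem]
      rintro t ⟨⟨-, ht⟩, htn⟩
      obtain ⟨h0, h1, -⟩ := bounds_of_level_eq hn0 htn
      have h2 : t < ((m : ℝ) + 1)⁻¹ := ht.2.trans_lt hh
      rw [← one_div, lt_div_iff₀ (by positivity)] at h2
      have h3 : (n : ℝ) ≤ m := by exact_mod_cast (Finset.mem_range.1 hn).le
      nlinarith
    rw [this]
    simp
  · exact (primitive_mono (subset_univ _) n).trans (le_abs_self _)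

/-- To the right of `1/(n+2)` only levels up to `n + 1` occur. This leaves `n + 2` coordinates, each
with error at most `n + 1` times the excess. -/
theorem norm_primitive_sub_le {l r : ℝ} (hI : Icc l r ⊆ Icc 0 1) (hlr : l ≤ r) {n : ℕ}
    (hn : Icc l r ⊆ Ioi (((n : ℝ) + 2)⁻¹)) :
    ‖primitive (Icc l r) - (r - l) • lp.single 2 n (n : ℝ)‖ ≤
      (n + 2) * (n + 1) * volume.real (Icc l r \ level ⁻¹' {n}) := by
  set x := primitive (Icc l r) - (r - l) • lp.single 2 n (n : ℝ) with hx
  set e := volume.real (Icc l r \ level ⁻¹' {n}) with he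
  have he0 : 0 ≤ e := measureReal_nonneg
  have hxm : ∀ m, x m = m * volume.real (Icc l r ∩ level ⁻¹' {m}) -
      (r - l) * if m = n then (n : ℝ) else 0 := by
    intro m
    have h1 : x m = primitive (Icc l r) m -
      (r - l) * lp.single (E := fun _ : ℕ => ℝ) 2 n (n : ℝ) m := rfl
    rw [h1, primitive_apply, inter_eq_self_of_subset_right hI, lp.single_apply, Pi.single_apply]
  have hle : ∀ m ∈ Finset.range (n + 2), ‖x m‖ ≤ (n + 1) * e := by
    intro m hm
    have hmn : (m : ℝ) ≤ n + 1 := by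
      have := Finset.mem_range.1 hm
      exact_mod_cast Nat.lt_succ_iff.1 this
    rw [hxm]
    split_ifs with h
    · subst h
      have h1 := measureReal_inter_add_sdiff (μ := volume) (s := Icc l r)
        (measurable_level (measurableSet_singleton m)) (by simp)
      rw [Real.volume_real_Icc_of_le hlr] at h1
      rw [← h1, Real.norm_eq_abs, abs_le]
      constructor <;> nlinarith [Nat.cast_nonneg (α := ℝ) m]
    · rw [mul_zero, sub_zero, Real.norm_of_nonneg (by positivity)]
      refine mul_le_mul hmn (measureReal_mono (fun t ht => ⟨ht.1, fun htn => h ?_⟩)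
        (measure_ne_top_of_subset sdiff_subset (by simp))) measureReal_nonneg (by positivity)
      exact (show level t = m from ht.2).symm.trans htn
  have hzero : ∀ m ∉ Finset.range (n + 2), x m = 0 := by
    intro m hm
    rw [Finset.mem_range, not_lt] at hm
    have hmn : ((n : ℝ) + 2) ≤ m := by exact_mod_cast hm
    have : Icc l r ∩ level ⁻¹' {m} = ∅ := by
      rw [Set.eq_empty_iff_forall_notMem]
      rintro t ⟨ht, htm⟩
      obtain ⟨h0, -, h1⟩ := bounds_of_level_eq (by omega) htm
      have h2 : ((n : ℝ) + 2)⁻¹ < t := hn ht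
      rw [inv_lt_iff_one_lt_mul₀ (by positivity)] at h2
      nlinarith
    rw [hxm, this, if_neg (by omega)]
    simp
  have hsum : x = ∑ m ∈ Finset.range (n + 2), lp.single 2 m (x m) := by
    rw [← sub_eq_zero]
    apply lp.ext
    funext m
    rw [sub_sum_single_apply]
    split_ifs with h
    · rfl
    · exact hzero m h
  calc ‖x‖ ≤ ∑ m ∈ Finset.range (n + 2), ‖lp.single (E := fun _ : ℕ => ℝ) 2 m (x m)‖ := by
        conv_lhs => rw [hsum]
        exact norm_sum_le _ _
    _ ≤ ∑ m ∈ Finset.range (n + 2), (n + 1) * e := Finset.sum_le_sum fun m hm => by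
        rw [lp.norm_single (by norm_num)]; exact hle m hm
    _ = (n + 2) * (n + 1) * e := by
        rw [Finset.sum_const, Finset.card_range, nsmul_eq_mul]; push_cast; ring

/-- Tags `t > 0` are handled by the weighted excess. The tag `0` can occur only in the first
interval, because Perron tags lie in their intervals, and there the primitive itself is small. With
free tags this last point fails. -/
theorem exists_gauge_sum_norm_primitive_sub_lt {ε : ℝ} (hε : 0 < ε) :
    ∃ δ, IsGauge δ ∧ ∀ P : TaggedPartition, P.IsPerron → P.IsFine δ →
      ∑ i, ‖primitive (Icc (P.left i) (P.right i)) - P.len i • harmonicFun (P.tag i)‖ < ε := by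
  obtain ⟨ρ, hρ, hsmall⟩ := exists_norm_primitive_lt (ε := ε / 2) (half_pos hε)
  have hC : ∀ n : ℕ, (0 : ℝ) < (n + 2) * (n + 1) := fun n => by positivity
  obtain ⟨δ, hδ, hδP⟩ := exists_measurableGauge_sum_excess_le measurable_level
    (η := fun n => ε / 4 / 2 / 2 ^ n / ((n + 2) * (n + 1))) (fun n => by positivity)
    (V := fun n => if n = 0 then Iio ρ else Ioi (((n : ℝ) + 2)⁻¹))
    (fun n => by split_ifs; exacts [isOpen_Iio, isOpen_Ioi]) (fun t ht => by
      split_ifs with h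
      · rcases ht.1.eq_or_lt with h0 | h0
        · rw [← h0]; exact hρ
        · exact absurd h (level_pos h0 ht.2).ne'
      · obtain ⟨h0, h1, -⟩ := bounds_of_level_eq h rfl
        rw [mem_Ioi, inv_lt_iff_one_lt_mul₀ (by positivity)]
        nlinarith)
  refine ⟨δ, hδ.1, fun P hPP hP => ?_⟩
  obtain ⟨hV, hex⟩ := hδP P hP
  have htot := sum_excess_le P (fun n => (hC n).le) hex (θ := ε / 4)
    (fun n => by rw [mul_div_cancel₀ _ (hC n).ne']) (by positivity)
  have hterm : ∀ i, ‖primitive (Icc (P.left i) (P.right i)) - P.len i • harmonicFun (P.tag i)‖ ≤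
      ((level (P.tag i) : ℝ) + 2) * (level (P.tag i) + 1) *
        volume.real (Icc (P.left i) (P.right i) \ level ⁻¹' {level (P.tag i)}) +
      if P.left i = 0 then ε / 2 else 0 := by
    intro i
    by_cases h : level (P.tag i) = 0
    · have ht : P.tag i = 0 := by
        by_contra hne
        exact (level_pos ((P.tag_mem i).1.lt_of_ne' hne) (P.tag_mem i).2).ne' h
      have hl : P.left i = 0 := le_antisymm (ht ▸ (hPP i).1) (P.left_nonneg i)
      have hr := hV i (right_mem_Icc.2 (P.left_lt_right i).le)
      rw [if_pos h] at hr
      rw [if_pos hl, ht, harmonicFun_zero, smul_zero, sub_zero, hl]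
      have := (hsmall _ hr).le
      have h3 : 0 ≤ volume.real (Icc 0 (P.right i) \ level ⁻¹' {level 0}) := measureReal_nonneg
      have h4 := mul_nonneg (hC (level 0)).le h3
      linarith
    · have h2 := hV i
      rw [if_neg h] at h2
      refine le_add_of_le_of_nonneg
        (norm_primitive_sub_le (P.Icc_subset i) (P.left_lt_right i).le h2) ?_
      split_ifs
      · positivity
      · exact le_rfl
  have hone : ∑ i, (if P.left i = 0 then ε / 2 else 0) ≤ ε / 2 := by
    rw [← Finset.sum_filter, Finset.sum_const, nsmul_eq_mul]
    have : (Finset.univ.filter fun i => P.left i = 0).card ≤ 1 := by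
      refine Finset.card_le_one.2 fun i hi j hj => ?_
      have h1 := (Finset.mem_filter.1 hi).2
      have h2 := (Finset.mem_filter.1 hj).2
      exact Fin.castSucc_injective _ (P.strictMono_pt.injective (h1.trans h2.symm))
    have h' : ((Finset.univ.filter fun i => P.left i = 0).card : ℝ) ≤ 1 := by exact_mod_cast this
    nlinarith
  refine (Finset.sum_le_sum fun i _ => hterm i).trans_lt ?_
  rw [Finset.sum_add_distrib]
  linarith

theorem hasSum_integral_comp_nat {μ : Measure ℝ} [IsFiniteMeasure μ] {N : ℝ → ℕ}
    (hN : Measurable N) (u : ℕ → ℝ) (hu : Summable fun n => |u n| * μ.real (N ⁻¹' {n})) :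
    Integrable (fun t => u (N t)) μ ∧
      HasSum (fun n => u n * μ.real (N ⁻¹' {n})) (∫ t, u (N t) ∂μ) := by
  have hm : ∀ n, MeasurableSet (N ⁻¹' {n}) := fun n => hN (measurableSet_singleton n)
  have hU : (⋃ n, N ⁻¹' {n}) = univ := by ext; simp
  have hconst : ∀ (v : ℕ → ℝ) (n : ℕ),
      ∫ t in N ⁻¹' {n}, v (N t) ∂μ = v n * μ.real (N ⁻¹' {n}) := by
    intro v n
    rw [setIntegral_congr_fun (g := fun _ => v n) (hm n) fun t ht => congrArg v ht,
      setIntegral_const, smul_eq_mul, mul_comm]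
  have hint : IntegrableOn (fun t => u (N t)) (⋃ n, N ⁻¹' {n}) μ := by
    refine integrableOn_iUnion_of_summable_integral_norm (fun n => ?_) ?_
    · exact (integrableOn_congr_fun (g := fun _ => u n) (fun t ht => congrArg u ht) (hm n)).2
        (integrable_const _).integrableOn
    · exact hu.congr fun n => (hconst (fun n => ‖u n‖) n).symm
  have hsum := hasSum_integral_iUnion hm
    (fun i j hij => Disjoint.preimage _ (disjoint_singleton.2 hij)) hint
  rw [hU, Measure.restrict_univ] at hsum
  rw [hU, integrableOn_univ] at hint
  exact ⟨hint, hsum.congr_fun fun n => (hconst u n).symm⟩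

end MultiIntegral

/-! ### Transfer of integrability through cone embeddings -/

namespace MultiIntegral

section Implications

variable {X : Type*} [NormedAddCommGroup X] [NormedSpace ℝ X] {Γ : ℝ → Set X} {Φ : Set X}

theorem HasBirkhoffIntegral.hasMcShaneIntegral (h : HasBirkhoffIntegral Γ Φ) :
    HasMcShaneIntegral Γ Φ :=
  ⟨h.1, fun ε hε => let ⟨δ, hδ, hP⟩ := h.2 ε hε; ⟨δ, hδ.1, hP⟩⟩

theorem HasBirkhoffIntegral.hasMeasurableHenstockIntegral (h : HasBirkhoffIntegral Γ Φ) :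
    HasMeasurableHenstockIntegral Γ Φ :=
  ⟨h.1, fun ε hε => let ⟨δ, hδ, hP⟩ := h.2 ε hε; ⟨δ, hδ, fun P _ => hP P⟩⟩

theorem HasMcShaneIntegral.hasHenstockIntegral (h : HasMcShaneIntegral Γ Φ) :
    HasHenstockIntegral Γ Φ :=
  ⟨h.1, fun ε hε => let ⟨δ, hδ, hP⟩ := h.2 ε hε; ⟨δ, hδ, fun P _ => hP P⟩⟩

end Implications

namespace IsConeEmbedding

variable {j : SeqSpace → Set SeqSpace}

theorem riemannSum_comp (hj : IsConeEmbedding j) {g : ℝ → SeqSpace} (hg : ∀ t, IsNonneg (g t))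
    (P : TaggedPartition) :
    riemannSum (fun t => j (g t)) P = j (∑ i, P.len i • g (P.tag i)) := by
  rw [hj.map_sum _ _ fun i _ => (hg _).smul (P.len_pos i).le]
  exact Finset.sum_congr rfl fun i _ => (hj.map_smul _ _ (P.len_pos i).le (hg _)).symm

theorem hasBirkhoffIntegral_indicator (hj : IsConeEmbedding j) {A : Set ℝ}
    (hA : MeasurableSet A) :
    HasBirkhoffIntegral (A.indicator fun t => j (harmonicFun t)) (j (primitive A)) := by
  have hg : ∀ t, IsNonneg (A.indicator harmonicFun t) := fun t => by
    by_cases ht : t ∈ A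
    · rw [indicator_of_mem ht]; exact isNonneg_harmonicFun t
    · rw [indicator_of_notMem ht]; exact IsNonneg.zero
  have h : (A.indicator fun t => j (harmonicFun t)) = fun t => j (A.indicator harmonicFun t) := by
    funext t
    by_cases ht : t ∈ A
    · rw [indicator_of_mem ht, indicator_of_mem ht]
    · rw [indicator_of_notMem ht, indicator_of_notMem ht, hj.map_zero]
  refine ⟨hj.isCB _ (isNonneg_primitive A), fun ε hε => ?_⟩
  obtain ⟨δ, hδ, hP⟩ := exists_measurableGauge_harmonicFun hA hε
  refine ⟨δ, hδ, fun P hPδ => ?_⟩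
  rw [h, hj.riemannSum_comp hg]
  exact (hj.hausdorffDist_le _ _ (isNonneg_primitive A)
    (IsNonneg.sum fun i _ => (hg _).smul (P.len_pos i).le)).trans_lt (hP P hPδ)

theorem variationallyHenstockIntegrable (hj : IsConeEmbedding j) :
    VariationallyHenstockIntegrable fun t => j (harmonicFun t) := by
  refine ⟨fun a b => j (primitive (Icc a b)), fun a b _ _ _ =>
    (hj.hasBirkhoffIntegral_indicator measurableSet_Icc).hasMcShaneIntegral.hasHenstockIntegral,
    fun ε hε => ?_⟩
  obtain ⟨δ, hδ, hP⟩ := exists_gauge_sum_norm_primitive_sub_lt hε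
  refine ⟨δ, hδ, fun P hPP hPδ => (Finset.sum_le_sum fun i _ => ?_).trans_lt (hP P hPP hPδ)⟩
  rw [← hj.map_smul _ _ (P.len_pos i).le (isNonneg_harmonicFun _)]
  exact hj.hausdorffDist_le _ _ (isNonneg_primitive _)
    ((isNonneg_harmonicFun _).smul (P.len_pos i).le)

theorem pettisIntegrable (hj : IsConeEmbedding j) :
    PettisIntegrable fun t => j (harmonicFun t) := by
  have key : ∀ φ : StrongDual ℝ SeqSpace, ∀ A ⊆ Icc (0 : ℝ) 1,
      IntegrableOn (fun t => supportFn φ (j (harmonicFun t))) A ∧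
      supportFn φ (j (primitive A)) = ∫ t in A, supportFn φ (j (harmonicFun t)) := by
    intro φ A hA
    obtain ⟨w, hw⟩ := hj.hasSum_supportFn φ
    have hfin : volume A ≠ ⊤ := measure_ne_top_of_subset hA (by simp)
    have : IsFiniteMeasure (volume.restrict A) := isFiniteMeasure_restrict.2 hfin
    have hval : ∀ t, supportFn φ (j (harmonicFun t)) = w (level t) * level t := by
      intro t
      refine (hw _ (isNonneg_harmonicFun t)).unique ?_
      convert hasSum_single (level t) ?_ using 1
      · rw [harmonicFun, lp.single_apply_self]
      · intro n hn
        rw [harmonicFun, lp.single_apply_ne _ _ _ hn, mul_zero]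
    have hμ : ∀ n : ℕ, (n : ℝ) * (volume.restrict A).real (level ⁻¹' {n}) = primitive A n := by
      intro n
      rw [measureReal_restrict_apply (measurable_level (measurableSet_singleton n)),
        primitive_apply, inter_eq_self_of_subset_right hA, inter_comm]
    have hsum := hw _ (isNonneg_primitive A)
    -- The series for the support function of `j (primitive A)` is real and summable, hence
    -- absolutely summable. This gives integrability on `A` as well as the value of the integral.
    obtain ⟨h1, h2⟩ := hasSum_integral_comp_nat (μ := volume.restrict A) measurable_level
      (fun n => w n * n) (by
        refine hsum.summable.abs.congr fun n => ?_
        rw [← hμ, abs_mul, abs_mul, abs_mul, mul_assoc, abs_of_nonneg measureReal_nonneg])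
    simp only [hval]
    refine ⟨h1, hsum.unique (h2.congr_fun fun n => ?_)⟩
    rw [← hμ, mul_assoc]
  exact ⟨fun φ => (key φ _ Subset.rfl).1, fun A hA _ =>
    ⟨j (primitive A), hj.isCWK _ (isNonneg_primitive A), fun φ => (key φ A hA).2⟩⟩

theorem integrable (hj : IsConeEmbedding j) (k : Kind) :
    k.Integrable fun t => j (harmonicFun t) := by
  have hB : HasBirkhoffIntegral (fun t => j (harmonicFun t)) (j (primitive univ)) := by
    simpa only [indicator_univ] using hj.hasBirkhoffIntegral_indicator MeasurableSet.univ
  cases k with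
  | henstock => exact ⟨_, hB.hasMcShaneIntegral.hasHenstockIntegral⟩
  | measurableHenstock => exact ⟨_, hB.hasMeasurableHenstockIntegral⟩
  | variationalHenstock => exact hj.variationallyHenstockIntegrable
  | pettis => exact hj.pettisIntegrable
  | mcShane => exact ⟨_, hB.hasMcShaneIntegral⟩
  | birkhoff => exact ⟨_, hB⟩

end IsConeEmbedding

/-! ### Divergence of `1/t`: failure of Bochner and variational McShane integrability -/

theorem not_integrableOn_harmonicFun : ¬ IntegrableOn harmonicFun (Icc (0 : ℝ) 1) := by
  intro h
  have h1 : IntegrableOn (fun t : ℝ => t⁻¹) (Ioc (0 : ℝ) 1) := by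
    refine ((h.mono_set Ioc_subset_Icc_self).norm.const_mul 2).mono'
      measurable_inv.aestronglyMeasurable ?_
    filter_upwards [ae_restrict_mem measurableSet_Ioc] with t ht
    rw [Real.norm_of_nonneg (inv_nonneg.2 ht.1.le)]
    exact inv_le_two_mul_norm_harmonicFun ht.1 ht.2
  have h2 := (intervalIntegrable_iff_integrableOn_Ioc_of_le zero_le_one).2 h1
  rw [intervalIntegrable_inv_iff] at h2
  simp at h2

namespace TaggedPartition

/-- Partition of `[0,1]` into `m + 1` intervals of equal length. -/
noncomputable def uniform (m : ℕ) (tag : Fin (m + 1) → ℝ) (h : ∀ i, tag i ∈ Icc (0 : ℝ) 1) :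
    TaggedPartition where
  n := m + 1
  pt i := i / ((m : ℝ) + 1)
  tag := tag
  strictMono_pt i k hik := by
    have : ((i : ℕ) : ℝ) < ((k : ℕ) : ℝ) := by exact_mod_cast hik
    exact div_lt_div_of_pos_right this (by positivity)
  pt_zero := by simp
  pt_last := by
    rw [Fin.val_last]
    push_cast
    exact div_self (by positivity)
  tag_mem := h

/-- With free tags, a Lebesgue number of the cover by gauge balls suffices: cut uniformly below it
and tag each interval by the centre of a ball that contains it. -/
theorem exists_isFine {δ : ℝ → ℝ} (hδ : IsGauge δ) {η : ℝ} (hη : 0 < η) :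
    ∃ P : TaggedPartition, P.IsFine δ ∧ ∀ i, P.len i < η := by
  obtain ⟨e, he, hcov⟩ := lebesgue_number_lemma_of_metric (s := Icc (0 : ℝ) 1)
    (c := fun t : Icc (0 : ℝ) 1 => Metric.ball (t : ℝ) (δ t)) isCompact_Icc
    (fun _ => Metric.isOpen_ball)
    fun t ht => mem_iUnion.2 ⟨⟨t, ht⟩, Metric.mem_ball_self (hδ t ht)⟩
  obtain ⟨m, hm⟩ := exists_nat_one_div_lt (lt_min he hη)
  have hm1 : (0 : ℝ) < (m : ℝ) + 1 := by positivity
  have hmem : ∀ i : Fin (m + 1), (i : ℝ) / ((m : ℝ) + 1) ∈ Icc (0 : ℝ) 1 := by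
    intro i
    have : ((i : ℕ) : ℝ) ≤ m := by exact_mod_cast Nat.lt_succ_iff.1 i.2
    exact ⟨by positivity, (div_le_one hm1).2 (by linarith)⟩
  choose c hc using fun i => hcov _ (hmem i)
  have hlen : ∀ i, (uniform m (fun i => c i) fun i => (c i).2).len i = 1 / ((m : ℝ) + 1) := by
    intro i
    change (((i.succ : Fin (m + 2)) : ℕ) : ℝ) / ((m : ℝ) + 1) -
      (((i.castSucc : Fin (m + 2)) : ℕ) : ℝ) / ((m : ℝ) + 1) = 1 / ((m : ℝ) + 1)
    rw [← sub_div, Fin.val_succ, Fin.val_castSucc]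
    push_cast
    ring
  refine ⟨uniform m (fun i => c i) fun i => (c i).2, fun i x hx => ?_, fun i => ?_⟩
  · have hl := hlen i
    rw [len] at hl
    have h1 : x ∈ Metric.ball ((uniform m (fun i => c i) fun i => (c i).2).left i) e := by
      rw [Metric.mem_ball, Real.dist_eq, abs_of_nonneg (by linarith [hx.1])]
      linarith [hx.2, min_le_left e η]
    have h2 := hc i h1
    rw [Metric.mem_ball, Real.dist_eq, abs_lt] at h2
    change x ∈ Icc ((c i : ℝ) - δ (c i)) ((c i : ℝ) + δ (c i))
    constructor <;> linarith
  · rw [hlen]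
    exact hm.trans_le (min_le_right _ _)

/-- Replace all tags of intervals starting to the left of `d` by `0`. -/
noncomputable def retag (P : TaggedPartition) (d : ℝ) : TaggedPartition where
  __ := P
  tag i := if P.left i < d then 0 else P.tag i
  tag_mem i := by
    split_ifs
    · exact ⟨le_rfl, zero_le_one⟩
    · exact P.tag_mem i

theorem IsFine.mono {P : TaggedPartition} {δ δ' : ℝ → ℝ} (h : P.IsFine δ)
    (hle : ∀ t ∈ Icc (0 : ℝ) 1, δ t ≤ δ' t) : P.IsFine δ' := fun i =>
  (h i).trans (Icc_subset_Icc (by linarith [hle _ (P.tag_mem i)])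
    (by linarith [hle _ (P.tag_mem i)]))

end TaggedPartition

/-- If a translate of `A` contains the ends of the segment `[0, y]` and `B` is contained in a
singleton, then dilations of `A` and `B` are at distance at least half the length of the segment. -/
theorem mul_norm_le_two_mul_hausdorffDist {X : Type*} [NormedAddCommGroup X] [NormedSpace ℝ X]
    {A B : Set X} {u p y : X} (hB : B ⊆ {p}) (hu : u ∈ A) (huy : u + y ∈ A) {r : ℝ} (hr : 0 ≤ r)
    (hfin : Metric.hausdorffEDist (r • A) (r • B) ≠ ⊤) :
    r * ‖y‖ ≤ 2 * Metric.hausdorffDist (r • A) (r • B) := by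
  have hne : (r • B).Nonempty := by
    by_contra h
    rw [not_nonempty_iff_eq_empty] at h
    rw [h] at hfin
    exact hfin (Metric.hausdorffEDist_empty ⟨_, smul_mem_smul_set hu⟩)
  have hrB : r • B = {r • p} := by
    refine (hne.subset_singleton_iff).1 ?_
    rw [← smul_set_singleton]
    exact smul_set_mono hB
  have hd : ∀ x ∈ A, dist (r • x) (r • p) ≤ Metric.hausdorffDist (r • A) (r • B) := by
    intro x hx
    have := Metric.infDist_le_hausdorffDist_of_mem (smul_mem_smul_set (a := r) hx) hfin
    rwa [hrB, Metric.infDist_singleton, ← hrB] at this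
  have h1 := dist_triangle_right (r • (u + y)) (r • u) (r • p)
  rw [dist_eq_norm, ← smul_sub, add_sub_cancel_left, norm_smul, Real.norm_of_nonneg hr] at h1
  linarith [hd _ hu, hd _ huy]

/-- From `log x ≤ x - 1`. Clamping to `[η, d]` gives increments that telescope over `[0, 1]` to `log
(d / η)`. -/
theorem log_clamp_sub_le {η d l r c : ℝ} (hη : 0 < η) (hlr : l ≤ r) (hld : l < d) (hc : 0 < c)
    (hcl : c ≤ l) : Real.log (max η (min r d)) - Real.log (max η (min l d)) ≤ (r - l) * c⁻¹ := by
  have hl0 : 0 < max η (min l d) := lt_max_of_lt_left hη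
  have hr0 : 0 < max η (min r d) := lt_max_of_lt_left hη
  have h1 : max η (min r d) - max η (min l d) ≤ r - l := by
    rw [sub_le_iff_le_add]
    refine max_le ?_ ?_
    · linarith [le_max_left η (min l d)]
    · have h2 := le_max_right η (min l d)
      rw [min_eq_left hld.le] at h2 ⊢
      linarith [min_le_left r d]
  have h3 : c ≤ max η (min l d) := by
    rw [min_eq_left hld.le]
    exact hcl.trans (le_max_right _ _)
  rw [← Real.log_div hr0.ne' hl0.ne']
  refine (Real.log_le_sub_one_of_pos (div_pos hr0 hl0)).trans ?_
  rw [← div_self hl0.ne', ← sub_div, ← div_eq_mul_inv]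
  exact (div_le_div_of_nonneg_right h1 hl0.le).trans
    (div_le_div_of_nonneg_left (by linarith) hc h3)

theorem not_variationallyMcShaneIntegrable_of_add {G : ℝ → Set SeqSpace} {g : ℝ → SeqSpace}
    (hG : ∀ t ∈ Icc (0 : ℝ) 1, IsCB (G t))
    (hGg : ∀ t ∈ Icc (0 : ℝ) 1, convexHull ℝ {0, harmonicFun t} = G t + {g t}) :
    ¬ VariationallyMcShaneIntegrable G := by
  rintro ⟨Φ, hΦ, hvar⟩
  obtain ⟨δ, hδ, hδP⟩ := hvar 1 one_pos
  have h0mem : (0 : ℝ) ∈ Icc (0 : ℝ) 1 := ⟨le_rfl, zero_le_one⟩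
  -- The value `harmonicFun 0 = 0` forces `G 0` to be a point.
  have hG0 : G 0 ⊆ {-g 0} := by
    intro x hx
    have h1 : x + g 0 ∈ G 0 + {g 0} := add_mem_add hx rfl
    rw [← hGg 0 h0mem, harmonicFun_zero, pair_eq_singleton, convexHull_singleton] at h1
    exact eq_neg_of_add_eq_zero_left h1
  have hends : ∀ t ∈ Icc (0 : ℝ) 1, ∃ u ∈ G t, u + harmonicFun t ∈ G t := by
    intro t ht
    have h1 : (0 : SeqSpace) ∈ G t + {g t} := hGg t ht ▸ subset_convexHull ℝ _ (by simp)
    have h2 : harmonicFun t ∈ G t + {g t} := hGg t ht ▸ subset_convexHull ℝ _ (by simp)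
    rw [add_singleton] at h1 h2
    obtain ⟨u, hu, hu0⟩ := h1
    obtain ⟨v, hv, hv0⟩ := h2
    refine ⟨u, hu, ?_⟩
    have h3 : u + harmonicFun t = v := by
      have hu0 : u + g t = 0 := hu0
      have hv0 : v + g t = harmonicFun t := hv0
      rw [← hv0, add_comm v, ← add_assoc, hu0, zero_add]
    rwa [h3]
  have hδ0 := hδ 0 h0mem
  set d : ℝ := min (δ 0 / 2) 1 with hd
  have hd0 : 0 < d := lt_min (half_pos hδ0) one_pos
  -- Then `log (d / η) = 17`, which exceeds the bound `8 * (1 + 1)` obtained below.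
  set η : ℝ := d * Real.exp (-17) with hη
  have hη0 : 0 < η := mul_pos hd0 (Real.exp_pos _)
  have hηd : η ≤ d := mul_le_of_le_one_right hd0.le (Real.exp_le_one_iff.2 (by norm_num))
  -- An interval tagged `0` stays in `[0, η]`, where the clamped logarithm is constant; one tagged
  -- `t > 0` stays to the right of `t / 2`.
  set δ' : ℝ → ℝ := fun t => if t = 0 then min (δ 0) η else min (δ t) (t / 2) with hδ'
  have hδ'g : IsGauge δ' := by
    intro t ht
    simp only [hδ']
    split_ifs with h
    · exact lt_min hδ0 hη0
    · exact lt_min (hδ t ht) (half_pos (ht.1.lt_of_ne' h))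
  obtain ⟨P, hP, hPd⟩ := TaggedPartition.exists_isFine hδ'g hd0
  have hPδ : P.IsFine δ := hP.mono fun t _ => by
    simp only [hδ']
    split_ifs with h
    · rw [h]; exact min_le_left _ _
    · exact min_le_left _ _
  -- A retagged interval starts before `d` and is shorter than `d`, so it lies in `[0, 2d] ⊆ [0, δ
  -- 0]`.
  have hQδ : (P.retag d).IsFine δ := by
    intro i
    change Icc (P.left i) (P.right i) ⊆ Icc ((if P.left i < d then 0 else P.tag i) -
      δ (if P.left i < d then 0 else P.tag i)) ((if P.left i < d then 0 else P.tag i) +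
      δ (if P.left i < d then 0 else P.tag i))
    split_ifs with h
    · have h1 : P.right i - P.left i < d := hPd i
      have h2 : d ≤ δ 0 / 2 := min_le_left _ _
      exact Icc_subset_Icc (by linarith [P.left_nonneg i]) (by linarith)
    · exact hPδ i
  have hS := hδP P hPδ
  have hT : ∑ i, Metric.hausdorffDist (Φ (P.left i) (P.right i))
      (P.len i • G (if P.left i < d then 0 else P.tag i)) < 1 := hδP (P.retag d) hQδ
  -- The factor `8` is `2 * 2 * 2`: from `(t / 2)⁻¹`, from `t⁻¹ ≤ 2 ‖f t‖`, and from the distance of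
  -- a segment to a point.
  have hterm : ∀ i, Real.log (max η (min (P.right i) d)) - Real.log (max η (min (P.left i) d)) ≤
      8 * (Metric.hausdorffDist (Φ (P.left i) (P.right i)) (P.len i • G (P.tag i)) +
        Metric.hausdorffDist (Φ (P.left i) (P.right i))
          (P.len i • G (if P.left i < d then 0 else P.tag i))) := by
    intro i
    have hlr := P.left_lt_right i
    split_ifs with hl
    · have ht := P.tag_mem i
      have hfine := hP i
      rcases ht.1.eq_or_lt with h0 | h0
      · have h1 : P.right i ≤ η := by
          have := (hfine (right_mem_Icc.2 hlr.le)).2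
          rw [← h0] at this
          simp only [hδ', if_true, zero_add] at this
          exact this.trans (min_le_right _ _)
        rw [max_eq_left ((min_le_left _ _).trans h1),
          max_eq_left ((min_le_left _ _).trans (hlr.le.trans h1)), sub_self]
        exact mul_nonneg (by norm_num)
          (add_nonneg Metric.hausdorffDist_nonneg Metric.hausdorffDist_nonneg)
      · have h1 : P.tag i / 2 ≤ P.left i := by
          have := (hfine (left_mem_Icc.2 hlr.le)).1
          simp only [hδ', if_neg h0.ne'] at this
          linarith [min_le_right (δ (P.tag i)) (P.tag i / 2)]
        have h2 := log_clamp_sub_le hη0 hlr.le hl (half_pos h0) h1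
        -- Nonempty bounded sets have finite Hausdorff distance; at infinite distance
        -- `hausdorffDist` would be `0` and the estimates would be void.
        have hI := (hΦ _ _ (P.left_nonneg i) hlr (P.right_le_one i)).1
        have hb : ∀ t ∈ Icc (0 : ℝ) 1, (P.len i • G t).Nonempty ∧
            Bornology.IsBounded (P.len i • G t) := fun t ht =>
          ⟨(hG t ht).1.smul_set, (hG t ht).2.2.2.smul₀ _⟩
        obtain ⟨u, hu, hu'⟩ := hends _ ht
        have h3 := mul_norm_le_two_mul_hausdorffDist hG0 hu hu' (P.len_pos i).le
          (Metric.hausdorffEDist_ne_top_of_nonempty_of_bounded (hb _ ht).1 (hb _ h0mem).1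
            (hb _ ht).2 (hb _ h0mem).2)
        have h4 := Metric.hausdorffDist_triangle (u := P.len i • G 0)
          (Metric.hausdorffEDist_ne_top_of_nonempty_of_bounded (hb _ ht).1 hI.1
            (hb _ ht).2 hI.2.2.2)
        rw [Metric.hausdorffDist_comm (s := P.len i • G (P.tag i))
          (t := Φ (P.left i) (P.right i))] at h4
        have h5 := mul_le_mul_of_nonneg_left (inv_le_two_mul_norm_harmonicFun h0 ht.2)
          (P.len_pos i).le
        have h6 : (P.right i - P.left i) * (P.tag i / 2)⁻¹ = 2 * (P.len i * (P.tag i)⁻¹) := by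
          rw [inv_div, TaggedPartition.len]; ring
        linarith
    · rw [not_lt] at hl
      rw [min_eq_right hl, min_eq_right (hl.trans hlr.le), sub_self]
      exact mul_nonneg (by norm_num)
        (add_nonneg Metric.hausdorffDist_nonneg Metric.hausdorffDist_nonneg)
  have htel := P.sum_sub_telescope fun x => Real.log (max η (min x d))
  have hle := Finset.sum_le_sum fun i (_ : i ∈ Finset.univ) => hterm i
  rw [htel, ← Finset.mul_sum, Finset.sum_add_distrib, min_eq_right (min_le_right _ _),
    max_eq_right hηd, min_eq_left hd0.le, max_eq_left hη0.le, hη,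
    Real.log_mul hd0.ne' (Real.exp_pos _).ne', Real.log_exp] at hle
  linarith

end MultiIntegral

theorem mainTheorem10 :
    ∃ (X : Type) (_ : NormedAddCommGroup X) (_ : NormedSpace ℝ X) (_ : CompleteSpace X)
      (f : ℝ → X) (Γ : ℝ → Set X),
      MultiIntegral.Kind.variationalHenstock.IntegrableFun f ∧
      MultiIntegral.Kind.pettis.IntegrableFun f ∧
      ¬ MeasureTheory.IntegrableOn f (Set.Icc (0 : ℝ) 1) MeasureTheory.volume ∧
      (∀ t ∈ Set.Icc (0 : ℝ) 1, Γ t = convexHull ℝ {0, f t}) ∧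
      (∀ t ∈ Set.Icc (0 : ℝ) 1, MultiIntegral.IsCWK (Γ t)) ∧
      ∀ k : MultiIntegral.Kind,
        k.Integrable Γ ∧
        ¬ ∃ (G : ℝ → Set X) (g : ℝ → X),
            (∀ t ∈ Set.Icc (0 : ℝ) 1, MultiIntegral.IsCB (G t)) ∧
            MultiIntegral.VariationallyMcShaneIntegrable G ∧
            k.IntegrableFun g ∧
            ∀ t ∈ Set.Icc (0 : ℝ) 1, Γ t = G t + {g t} := by
  have hconv : ∀ t, MultiIntegral.box (MultiIntegral.harmonicFun t) =
      convexHull ℝ {0, MultiIntegral.harmonicFun t} := fun t =>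
    MultiIntegral.box_single _ (Nat.cast_nonneg _)
  refine ⟨MultiIntegral.SeqSpace, inferInstance, inferInstance, inferInstance,
    MultiIntegral.harmonicFun, fun t => MultiIntegral.box (MultiIntegral.harmonicFun t),
    MultiIntegral.isConeEmbedding_singleton.integrable .variationalHenstock,
    MultiIntegral.isConeEmbedding_singleton.integrable .pettis,
    MultiIntegral.not_integrableOn_harmonicFun, fun t _ => hconv t,
    fun t _ => MultiIntegral.isConeEmbedding_box.isCWK _ (MultiIntegral.isNonneg_harmonicFun t),
    fun k => ⟨MultiIntegral.isConeEmbedding_box.integrable k, ?_⟩⟩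
  rintro ⟨G, g, hG, hvar, -, hGg⟩
  exact MultiIntegral.not_variationallyMcShaneIntegrable_of_add hG
    (fun t ht => (hconv t).symm.trans (hGg t ht)) hvar
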